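/- Let $\mathcal H_A,\mathcal H_B$ be finite-dimensional complex Hilbert spaces, $d_A=\dim\mathcal H_A$ and $d_{\min}=\min\{\dim\mathcal H_A,\dim\mathcal H_B\}$. Write $\log$ for the binary logarithm. Let $\rho_{AB}$ be a sub-normalized state on $\mathcal H_A\otimes\mathcal H_B$, i.e. a positive semi-definite operator with $0<\operatorname{tr}\rho_{AB}\le 1$. The conditional min-entropy is $$H_{\min}(A|B)_\rho := \sup_{\sigma_B}\ \sup\{\lambda\in\mathbb R : 2^{-\lambda}\,\mathbb 1_A\otimes\sigma_B\ge\rho_{AB}\},$$ where $\sigma_B$ ranges over the positive semi-definite operators on $\mathcal H_B$ with $\operatorname{tr}\sigma_B=1$ (and $\sup\emptyset=-\infty$). The conditional max-entropy is $$H_{\max}(A|B)_\rho := -H_{\min}(A|C)_\rho,$$ evaluated on the marginal $\rho_{AC}=\operatorname{tr}_B\rho_{ABC}$ of an arbitrary purification $\rho_{ABC}=|\psi\rangle\langle\psi|$, $\operatorname{tr}_C\rho_{ABC}=\rho_{AB}$, with $\mathcal H_C$ finite-dimensional. Then $$-\log d_{\min}\ \le\ H_{\min}(A|B)_\rho+\log\operatorname{tr}\rho_{AB}\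 \le\ \log d_A ,$$ and, for every choice of the purification, $$-\log d_{\min}\ \le\ H_{\max}(A|B)_\rho-\log\operatorname{tr}\rho_{AB}\ \le\ \log d_A .$$ -/

import Mathlib

open scoped Kronecker ComplexOrder

namespace QEntropy

/-- Sub-normalized states on `ℂ^n`: positive semi-definite operators with `0 < tr ρ ≤ 1`. -/
def IsSubnormState {n : Type*} [Fintype n] (ρ : Matrix n n ℂ) : Prop :=
  ρ.PosSemidef ∧ 0 < ρ.trace.re ∧ ρ.trace.re ≤ 1

/-- Normalized states on `ℂ^n`: positive semi-definite operators with `tr ρ = 1`. -/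
def IsNormState {n : Type*} [Fintype n] (ρ : Matrix n n ℂ) : Prop :=
  ρ.PosSemidef ∧ ρ.trace = 1

/-- The conditional min-entropy `H_min(A|B)`, the supremum over normalized states `σ` on `B` of
`sup {l ∈ ℝ : 2^(-l) 1_A ⊗ σ ≥ ρ}`. Suprema are taken in the extended reals, so that a `σ` which
admits no `l` contributes `-∞`. -/
noncomputable def condMinEntropy {a b : Type*} [Fintype a] [DecidableEq a] [Fintype b]
    (ρ : Matrix (a × b) (a × b) ℂ) : EReal :=
  ⨆ σ ∈ {σ : Matrix b b ℂ | IsNormState σ},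
    ⨆ l ∈ {l : ℝ | ((2 : ℝ) ^ (-l) • ((1 : Matrix a a ℂ) ⊗ₖ σ) - ρ).PosSemidef}, (l : EReal)

/-- The partial trace over `C` of an operator on `A ⊗ B ⊗ C`. -/
def ptraceC {a b c : Type*} [Fintype c] (ω : Matrix (a × b × c) (a × b × c) ℂ) :
    Matrix (a × b) (a × b) ℂ :=
  Matrix.of fun x y => ∑ k, ω (x.1, x.2, k) (y.1, y.2, k)

/-- The partial trace over `B` of an operator on `A ⊗ B ⊗ C`. -/
def ptraceB {a b c : Type*} [Fintype b] (ω : Matrix (a × b × c) (a × b × c) ℂ) :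
    Matrix (a × c) (a × c) ℂ :=
  Matrix.of fun x y => ∑ j, ω (x.1, j, x.2) (y.1, j, y.2)

/-- `ω` on `A ⊗ B ⊗ C` is a purification of `ρ` on `A ⊗ B`: it is of the form `|ψ⟩⟨ψ|` and its
marginal on `A ⊗ B` is `ρ`. -/
def IsPurification {a b c : Type*} [Fintype c]
    (ω : Matrix (a × b × c) (a × b × c) ℂ) (ρ : Matrix (a × b) (a × b) ℂ) : Prop :=
  (∃ ψ : a × b × c → ℂ, ω = Matrix.vecMulVec ψ (star ψ)) ∧ ptraceC ω = ρ

/-- The conditional max-entropy `H_max(A|B) = -H_min(A|C)`, computed from a purification `ω` on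
`A ⊗ B ⊗ C` of the state on `A ⊗ B`. -/
noncomputable def condMaxEntropy {a b c : Type*} [Fintype a] [DecidableEq a] [Fintype b]
    [Fintype c] (ω : Matrix (a × b × c) (a × b × c) ℂ) : EReal :=
  -condMinEntropy (ptraceB ω)

/-- Every positive semi-definite operator has a purification. -/
theorem exists_isPurification {a b : Type*} [Fintype a] [Fintype b]
    (ρ : Matrix (a × b) (a × b) ℂ) (hρ : ρ.PosSemidef) :
    ∃ ω : Matrix (a × b × (a × b)) (a × b × (a × b)) ℂ, IsPurification ω ρ := by
  classical
  obtain ⟨B, rfl⟩ : ∃ B : Matrix (a × b) (a × b) ℂ, ρ = star B * B := by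
    open scoped MatrixOrder in
    exact CStarAlgebra.nonneg_iff_eq_star_mul_self.mp hρ.nonneg
  refine ⟨_, ⟨fun x => star (B x.2.2 (x.1, x.2.1)), rfl⟩, ?_⟩
  ext x y
  simp [ptraceC, Matrix.vecMulVec_apply, Matrix.mul_apply, Matrix.star_apply]

end QEntropy

namespace QEntropy

/-! Everything reduces to the factors `s` with `ρ ≤ s • 1 ⊗ σ`. Small factors come from `ρ ≤ d_A • 1
⊗ ρ_B` (`σ` the normalized marginal) and `ρ ≤ tr ρ • 1` (`σ` maximally mixed); taking traces forces
`s ≥ tr ρ / d_A`. For `H_max` these bounds are applied to `ρ_AC` and negated. The bound by `d_B` is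
different: `ρ_AC` is a sum of `d_B` rank-one operators, each of norm at most `s`, so `tr ρ ≤ d_B *
s` (`condMinEntropy_sum_vecMulVec_le`). -/

/-- The quadratic form of a Gram matrix is a squared norm. -/
theorem star_dotProduct_gram_mulVec {m n : Type*} [Fintype m] [Fintype n]
    (M : Matrix m n ℂ) (x : n → ℂ) :
    star x ⬝ᵥ (M.conjTranspose * M).mulVec x = ((∑ i, ‖M.mulVec x i‖ ^ 2 : ℝ) : ℂ) := by
  rw [← Matrix.mulVec_mulVec, Matrix.dotProduct_mulVec, ← Matrix.star_mulVec, dotProduct]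
  push_cast
  exact Finset.sum_congr rfl fun i _ => Complex.conj_mul' _

/-- Every positive semi-definite matrix is a Gram matrix. -/
theorem exists_eq_gram {n : Type*} [Fintype n] {ρ : Matrix n n ℂ} (hρ : ρ.PosSemidef) :
    ∃ M : Matrix n n ℂ, ρ = M.conjTranspose * M := by
  classical
  open scoped MatrixOrder in
  exact CStarAlgebra.nonneg_iff_eq_star_mul_self.mp hρ.nonneg

theorem isHermitian_real_smul {n : Type*} {A : Matrix n n ℂ} (hA : A.IsHermitian) (r : ℝ) :
    (r • A).IsHermitian := by
  ext i j
  simp [← hA.apply i j]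

/-- The trace of a positive semi-definite matrix is real. -/
theorem trace_eq_ofReal_re {n : Type*} [Fintype n] {A : Matrix n n ℂ} (hA : A.PosSemidef) :
    A.trace = (A.trace.re : ℂ) :=
  Complex.ext rfl (Complex.nonneg_iff.mp hA.trace_nonneg).2.symm

theorem nonempty_of_trace_pos {n : Type*} [Fintype n] {A : Matrix n n ℂ}
    (h : 0 < A.trace.re) : Nonempty n := by
  by_contra hn
  rw [not_nonempty_iff] at hn
  simp [Matrix.trace] at h

/-! ### Operator inequalities -/

/-- A positive semi-definite matrix is bounded by its trace. -/
theorem posSemidef_trace_smul_one_sub {n : Type*} [Fintype n] [DecidableEq n]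
    {ρ : Matrix n n ℂ} (hρ : ρ.PosSemidef) :
    (ρ.trace.re • (1 : Matrix n n ℂ) - ρ).PosSemidef := by
  refine .of_dotProduct_mulVec_nonneg
    ((isHermitian_real_smul Matrix.isHermitian_one _).sub hρ.1) fun x => ?_
  obtain ⟨M, rfl⟩ := exists_eq_gram hρ
  have htr : (M.conjTranspose * M).trace.re = ∑ i, ∑ j, ‖M i j‖ ^ 2 := by
    rw [Finset.sum_comm]
    simp [Matrix.trace, Matrix.mul_apply, ← Complex.normSq_eq_conj_mul_self,
      Complex.normSq_eq_norm_sq, -Complex.ofReal_pow]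
  have hx : star x ⬝ᵥ x = ((∑ j, ‖x j‖ ^ 2 : ℝ) : ℂ) := by
    simpa using star_dotProduct_gram_mulVec (1 : Matrix n n ℂ) x
  rw [Matrix.sub_mulVec, dotProduct_sub, star_dotProduct_gram_mulVec, Matrix.smul_mulVec,
    Matrix.one_mulVec, dotProduct_smul, hx, htr, Complex.real_smul, ← Complex.ofReal_mul,
    ← Complex.ofReal_sub, Complex.zero_le_real, sub_nonneg, Finset.sum_mul]
  refine Finset.sum_le_sum fun i _ => ?_
  calc ‖M.mulVec x i‖ ^ 2 ≤ (∑ j, ‖M i j‖ * ‖x j‖) ^ 2 := by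
        gcongr
        simpa [Matrix.mulVec, dotProduct] using norm_sum_le Finset.univ fun j => M i j * x j
    _ ≤ _ := Finset.sum_mul_sq_le_sq_mul_sq _ _ _

/-- The partial trace over `A` of an operator on `A ⊗ B`. -/
def ptraceA {a b : Type*} [Fintype a] (ρ : Matrix (a × b) (a × b) ℂ) : Matrix b b ℂ :=
  ∑ i, ρ.submatrix (Prod.mk i) (Prod.mk i)

theorem ptraceA_posSemidef {a b : Type*} [Fintype a] {ρ : Matrix (a × b) (a × b) ℂ}
    (hρ : ρ.PosSemidef) : (ptraceA ρ).PosSemidef :=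
  Matrix.posSemidef_sum _ fun _ _ => hρ.submatrix _

theorem trace_ptraceA {a b : Type*} [Fintype a] [Fintype b] (ρ : Matrix (a × b) (a × b) ℂ) :
    (ptraceA ρ).trace = ρ.trace := by
  rw [ptraceA, Matrix.trace_sum, Matrix.trace, Fintype.sum_prod_type]
  rfl

/-- The operator inequality `ρ ≤ dim A • 1 ⊗ tr_A ρ`. -/
theorem posSemidef_card_smul_one_kronecker_ptraceA_sub {a b : Type*} [Fintype a] [DecidableEq a]
    [Fintype b] {ρ : Matrix (a × b) (a × b) ℂ} (hρ : ρ.PosSemidef) :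
    ((Fintype.card a : ℝ) • ((1 : Matrix a a ℂ) ⊗ₖ ptraceA ρ) - ρ).PosSemidef := by
  classical
  refine .of_dotProduct_mulVec_nonneg ((isHermitian_real_smul
    (Matrix.PosSemidef.one.kronecker (ptraceA_posSemidef hρ)).1 _).sub hρ.1) fun x => ?_
  obtain ⟨M, rfl⟩ := exists_eq_gram hρ
  -- Column blocks of `M`: the marginal is `∑ i, (N i)ᴴ * N i`, and `M x = ∑ i, N i x_i`.
  set N : a → Matrix (a × b) b ℂ := fun i => M.submatrix id (Prod.mk i) with hN
  have hk : (1 : Matrix a a ℂ) ⊗ₖ ptraceA (M.conjTranspose * M) =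
      ∑ i, ((1 : Matrix a a ℂ) ⊗ₖ N i).conjTranspose * ((1 : Matrix a a ℂ) ⊗ₖ N i) := by
    have (i : a) : ((1 : Matrix a a ℂ) ⊗ₖ N i).conjTranspose * ((1 : Matrix a a ℂ) ⊗ₖ N i) =
        (1 : Matrix a a ℂ) ⊗ₖ (M.conjTranspose * M).submatrix (Prod.mk i) (Prod.mk i) := by
      rw [Matrix.conjTranspose_kronecker, ← Matrix.mul_kronecker_mul]
      simp only [Matrix.conjTranspose_one, one_mul]
      rfl
    rw [Finset.sum_congr rfl fun i _ => this i]
    ext x y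
    simp [ptraceA, Matrix.sum_apply, Finset.mul_sum]
  have hNx (i i' : a) (k : a × b) : ((1 : Matrix a a ℂ) ⊗ₖ N i).mulVec x (i', k) =
      ∑ j, M k (i, j) * x (i', j) := by
    simp [Matrix.mulVec, dotProduct, Fintype.sum_prod_type, Matrix.one_apply, hN]
  have hMx (k : a × b) : M.mulVec x k = ∑ i, ((1 : Matrix a a ℂ) ⊗ₖ N i).mulVec x (i, k) := by
    simp only [hNx]
    exact Fintype.sum_prod_type _
  rw [Matrix.sub_mulVec, dotProduct_sub, star_dotProduct_gram_mulVec, Matrix.smul_mulVec,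
    dotProduct_smul, hk, Matrix.sum_mulVec, dotProduct_sum,
    Finset.sum_congr rfl fun i _ => star_dotProduct_gram_mulVec _ x, ← Complex.ofReal_sum,
    Complex.real_smul, ← Complex.ofReal_mul, ← Complex.ofReal_sub, Complex.zero_le_real,
    sub_nonneg]
  calc ∑ k, ‖M.mulVec x k‖ ^ 2
      ≤ ∑ k, (Fintype.card a : ℝ) * ∑ i, ‖((1 : Matrix a a ℂ) ⊗ₖ N i).mulVec x (i, k)‖ ^ 2 := by
        refine Finset.sum_le_sum fun k _ => ?_
        rw [hMx]
        -- Cauchy–Schwarz over the blocks produces the factor `dim A`.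
        exact (pow_le_pow_left₀ (norm_nonneg _) (norm_sum_le _ _) 2).trans
          sq_sum_le_card_mul_sum_sq
    _ = (Fintype.card a : ℝ) * ∑ i, ∑ k, ‖((1 : Matrix a a ℂ) ⊗ₖ N i).mulVec x (i, k)‖ ^ 2 := by
        rw [← Finset.mul_sum, Finset.sum_comm]
    _ ≤ _ := by
        -- The left side has only the terms `N i x_i`; the right side also has the nonnegative `N i
        -- x_i'` with `i' ≠ i`.
        refine mul_le_mul_of_nonneg_left (Finset.sum_le_sum fun i _ => ?_) (Nat.cast_nonneg _)
        refine (Finset.single_le_sum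
          (f := fun i' => ∑ k, ‖((1 : Matrix a a ℂ) ⊗ₖ N i).mulVec x (i', k)‖ ^ 2)
          (fun _ _ => Finset.sum_nonneg fun _ _ => by positivity)
          (Finset.mem_univ i)).trans_eq (Fintype.sum_prod_type
            fun p => ‖((1 : Matrix a a ℂ) ⊗ₖ N i).mulVec x p‖ ^ 2).symm

/-! ### Bounds on the min-entropy -/

theorem le_condMinEntropy {a b : Type*} [Fintype a] [DecidableEq a] [Fintype b]
    {ρ : Matrix (a × b) (a × b) ℂ} {σ : Matrix b b ℂ} (hσ : IsNormState σ) {r : ℝ} (hr : 0 < r)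
    (h : (r • ((1 : Matrix a a ℂ) ⊗ₖ σ) - ρ).PosSemidef) :
    ((-Real.logb 2 r : ℝ) : EReal) ≤ condMinEntropy ρ := by
  refine le_iSup₂_of_le σ hσ (le_iSup₂_of_le (-Real.logb 2 r) ?_ le_rfl)
  rwa [Set.mem_ofPred_eq, neg_neg, Real.rpow_logb two_pos (by norm_num) hr]

/-- Upper bounds on `H_min` from lower bounds on the factors `s` with `ρ ≤ s • 1 ⊗ σ`. -/
theorem condMinEntropy_le {a b : Type*} [Fintype a] [DecidableEq a] [Fintype b]
    {ρ : Matrix (a × b) (a × b) ℂ} {r : ℝ} (hr : 0 < r)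
    (h : ∀ σ : Matrix b b ℂ, IsNormState σ → ∀ s : ℝ, 0 < s →
      (s • ((1 : Matrix a a ℂ) ⊗ₖ σ) - ρ).PosSemidef → r ≤ s) :
    condMinEntropy ρ ≤ ((-Real.logb 2 r : ℝ) : EReal) := by
  refine iSup₂_le fun σ hσ => iSup₂_le fun l hl => ?_
  have := Real.logb_le_logb_of_le one_lt_two hr (h σ hσ _ (Real.rpow_pos_of_pos two_pos _) hl)
  rw [Real.logb_rpow two_pos (by norm_num)] at this
  exact EReal.coe_le_coe_iff.mpr (by linarith)

theorem neg_logb_card_left_mul_trace_le_condMinEntropy {a b : Type*} [Fintype a] [DecidableEq a]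
    [Fintype b] [Nonempty a] {ρ : Matrix (a × b) (a × b) ℂ} (hρ : ρ.PosSemidef)
    (ht : 0 < ρ.trace.re) :
    ((-Real.logb 2 (Fintype.card a * ρ.trace.re) : ℝ) : EReal) ≤ condMinEntropy ρ := by
  have hcard : (0 : ℝ) < Fintype.card a := mod_cast Fintype.card_pos
  refine le_condMinEntropy (σ := (ρ.trace.re : ℝ)⁻¹ • ptraceA ρ)
    ⟨(ptraceA_posSemidef hρ).smul (inv_nonneg.mpr ht.le), ?_⟩ (mul_pos hcard ht) ?_
  · rw [Matrix.trace_smul, trace_ptraceA]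
    nth_rw 2 [trace_eq_ofReal_re hρ]
    rw [Complex.real_smul, ← Complex.ofReal_mul, inv_mul_cancel₀ ht.ne', Complex.ofReal_one]
  · rw [Matrix.kronecker_smul, smul_smul, mul_assoc, mul_inv_cancel₀ ht.ne', mul_one]
    exact posSemidef_card_smul_one_kronecker_ptraceA_sub hρ

theorem neg_logb_card_right_mul_trace_le_condMinEntropy {a b : Type*} [Fintype a] [DecidableEq a]
    [Fintype b] [Nonempty b] {ρ : Matrix (a × b) (a × b) ℂ} (hρ : ρ.PosSemidef)
    (ht : 0 < ρ.trace.re) :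
    ((-Real.logb 2 (Fintype.card b * ρ.trace.re) : ℝ) : EReal) ≤ condMinEntropy ρ := by
  classical
  have hcard : (0 : ℝ) < Fintype.card b := mod_cast Fintype.card_pos
  refine le_condMinEntropy (σ := (Fintype.card b : ℝ)⁻¹ • (1 : Matrix b b ℂ))
    ⟨Matrix.PosSemidef.one.smul (inv_nonneg.mpr hcard.le), ?_⟩ (mul_pos hcard ht) ?_
  · rw [Matrix.trace_smul, Matrix.trace_one, Complex.real_smul]
    push_cast
    exact inv_mul_cancel₀ (mod_cast hcard.ne')
  · rw [Matrix.kronecker_smul, smul_smul, mul_right_comm, mul_inv_cancel₀ hcard.ne', one_mul,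
      Matrix.one_kronecker_one]
    exact posSemidef_trace_smul_one_sub hρ

theorem condMinEntropy_le_neg_logb_trace_div_card {a b : Type*} [Fintype a] [DecidableEq a]
    [Fintype b] [Nonempty a] {ρ : Matrix (a × b) (a × b) ℂ} (ht : 0 < ρ.trace.re) :
    condMinEntropy ρ ≤ ((-Real.logb 2 (ρ.trace.re / Fintype.card a) : ℝ) : EReal) := by
  have hcard : (0 : ℝ) < Fintype.card a := mod_cast Fintype.card_pos
  refine condMinEntropy_le (div_pos ht hcard) fun σ hσ s _ h => ?_
  have := (Complex.nonneg_iff.mp h.trace_nonneg).1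
  rw [Matrix.trace_sub, Matrix.trace_smul, Matrix.trace_kronecker, hσ.2, Matrix.trace_one] at this
  rw [div_le_iff₀ hcard]
  simpa using this

/-- If `ρ` is a sum of `card ι` rank-one operators, then `H_min ≤ log (card ι) - log (tr ρ)`. -/
theorem condMinEntropy_sum_vecMulVec_le {a b ι : Type*} [Fintype a] [DecidableEq a]
    [Fintype b] [Fintype ι] [Nonempty ι] (v : ι → a × b → ℂ) {ρ : Matrix (a × b) (a × b) ℂ}
    (hv : ρ = ∑ i, Matrix.vecMulVec (v i) (star (v i))) (ht : 0 < ρ.trace.re) :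
    condMinEntropy ρ ≤ ((-Real.logb 2 (ρ.trace.re / Fintype.card ι) : ℝ) : EReal) := by
  classical
  have hcard : (0 : ℝ) < Fintype.card ι := mod_cast Fintype.card_pos
  refine condMinEntropy_le (div_pos ht hcard) fun σ hσ s hs h => ?_
  -- Since `tr σ = 1`, `σ ≤ 1`, so `ρ ≤ s • 1 ⊗ σ ≤ s • 1`.
  have hone : (s • (1 : Matrix (a × b) (a × b) ℂ) - ρ).PosSemidef := by
    have h1 := posSemidef_trace_smul_one_sub hσ.1
    rw [hσ.2, Complex.one_re, one_smul] at h1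
    have h2 := ((Matrix.PosSemidef.one (n := a) (R := ℂ)).kronecker h1).smul hs.le
    have h3 : (1 : Matrix a a ℂ) ⊗ₖ (1 - σ) = 1 - (1 : Matrix a a ℂ) ⊗ₖ σ := by
      rw [← Matrix.one_kronecker_one]
      ext x y
      exact mul_sub _ _ _
    rw [h3, smul_sub] at h2
    simpa using h2.add h
  have hnorm (x : a × b → ℂ) : star x ⬝ᵥ x = ((∑ k, ‖x k‖ ^ 2 : ℝ) : ℂ) := by
    simpa using star_dotProduct_gram_mulVec (1 : Matrix (a × b) (a × b) ℂ) x
  have hbound (i : ι) : ∑ k, ‖v i k‖ ^ 2 ≤ s := by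
    set q := ∑ k, ‖v i k‖ ^ 2 with hq
    have hrest : (s • (1 : Matrix (a × b) (a × b) ℂ) -
        Matrix.vecMulVec (v i) (star (v i))).PosSemidef := by
      have := hone.add (Matrix.posSemidef_sum (Finset.univ.erase i)
        fun j _ => Matrix.posSemidef_vecMulVec_self_star (v j))
      rwa [hv, ← Finset.add_sum_erase _ _ (Finset.mem_univ i), ← sub_sub, sub_add_cancel] at this
    -- Testing against `v i` itself gives `q * q ≤ s * q`, hence `q ≤ s`.
    have h0 := hrest.dotProduct_mulVec_nonneg (v i)
    rw [Matrix.sub_mulVec, dotProduct_sub, Matrix.smul_mulVec, Matrix.one_mulVec,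
      dotProduct_smul, Matrix.vecMulVec_mulVec, dotProduct_smul, hnorm, ← hq] at h0
    simp only [Complex.real_smul, MulOpposite.smul_eq_mul_unop, MulOpposite.unop_op] at h0
    rw [← Complex.ofReal_mul, ← Complex.ofReal_mul, ← Complex.ofReal_sub,
      Complex.zero_le_real] at h0
    have hq0 : 0 ≤ q := Finset.sum_nonneg fun _ _ => by positivity
    nlinarith
  have htr : ρ.trace.re = ∑ i, ∑ k, ‖v i k‖ ^ 2 := by
    rw [hv, Matrix.trace_sum, Complex.re_sum]
    refine Finset.sum_congr rfl fun i _ => ?_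
    rw [Matrix.trace_vecMulVec, dotProduct_comm, hnorm, Complex.ofReal_re]
  rw [div_le_iff₀ hcard, htr, mul_comm]
  simpa using Finset.sum_le_sum fun i (_ : i ∈ Finset.univ) => hbound i

/-! ### Marginals of a purification and the final bounds -/

theorem ptraceB_vecMulVec {a b c : Type*} [Fintype b] (ψ : a × b × c → ℂ) :
    ptraceB (Matrix.vecMulVec ψ (star ψ)) =
      ∑ j, Matrix.vecMulVec (fun x : a × c => ψ (x.1, j, x.2))
        (star fun x : a × c => ψ (x.1, j, x.2)) := by
  ext x y
  simp [ptraceB, Matrix.sum_apply, Matrix.vecMulVec_apply]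

theorem trace_ptraceB {a b c : Type*} [Fintype a] [Fintype b] [Fintype c]
    (ω : Matrix (a × b × c) (a × b × c) ℂ) : (ptraceB ω).trace = (ptraceC ω).trace := by
  simp only [Matrix.trace, Fintype.sum_prod_type, Matrix.diag_apply, ptraceB, ptraceC,
    Matrix.of_apply]
  exact Finset.sum_congr rfl fun _ _ => Finset.sum_comm

/-- The bounds on the min-entropy, normalized by the trace. -/
theorem condMinEntropy_bounds {a b : Type*} [Fintype a] [DecidableEq a] [Fintype b] [Nonempty a]
    [Nonempty b] {ρ : Matrix (a × b) (a × b) ℂ} (hρ : ρ.PosSemidef) (ht : 0 < ρ.trace.re) :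
    ∃ h : ℝ, condMinEntropy ρ = h ∧
      -Real.logb 2 (min (Fintype.card a) (Fintype.card b) : ℕ) ≤ h + Real.logb 2 ρ.trace.re ∧
      -Real.logb 2 (Fintype.card a) ≤ h + Real.logb 2 ρ.trace.re ∧
      h + Real.logb 2 ρ.trace.re ≤ Real.logb 2 (Fintype.card a) := by
  have ha : (Fintype.card a : ℝ) ≠ 0 := mod_cast Fintype.card_ne_zero
  have hb : (Fintype.card b : ℝ) ≠ 0 := mod_cast Fintype.card_ne_zero
  have h1 := neg_logb_card_left_mul_trace_le_condMinEntropy hρ ht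
  have h2 := neg_logb_card_right_mul_trace_le_condMinEntropy hρ ht
  have h3 := condMinEntropy_le_neg_logb_trace_div_card (ρ := ρ) ht
  lift condMinEntropy ρ to ℝ using
    ⟨(h3.trans_lt (EReal.coe_lt_top _)).ne, ((EReal.bot_lt_coe _).trans_le h1).ne'⟩ with h
  rw [EReal.coe_le_coe_iff, Real.logb_mul ha ht.ne'] at h1
  rw [EReal.coe_le_coe_iff, Real.logb_mul hb ht.ne'] at h2
  rw [EReal.coe_le_coe_iff, Real.logb_div ht.ne' ha] at h3
  refine ⟨h, rfl, ?_, by linarith, by linarith⟩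
  rcases min_choice (Fintype.card a) (Fintype.card b) with hm | hm <;> rw [hm] <;> linarith

end QEntropy

theorem mainTheorem12 {a b : Type*} [Fintype a] [DecidableEq a] [Fintype b]
    (ρ : Matrix (a × b) (a × b) ℂ) (hρ : QEntropy.IsSubnormState ρ) :
    (-((Real.logb 2 (min (Fintype.card a) (Fintype.card b) : ℕ) : ℝ) : EReal)
        ≤ QEntropy.condMinEntropy ρ + ((Real.logb 2 ρ.trace.re : ℝ) : EReal) ∧
      QEntropy.condMinEntropy ρ + ((Real.logb 2 ρ.trace.re : ℝ) : EReal)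
        ≤ ((Real.logb 2 (Fintype.card a) : ℝ) : EReal)) ∧
    (∀ (c : Type*) [Fintype c] (ω : Matrix (a × b × c) (a × b × c) ℂ),
      QEntropy.IsPurification ω ρ →
        -((Real.logb 2 (min (Fintype.card a) (Fintype.card b) : ℕ) : ℝ) : EReal)
            ≤ QEntropy.condMaxEntropy ω - ((Real.logb 2 ρ.trace.re : ℝ) : EReal) ∧
          QEntropy.condMaxEntropy ω - ((Real.logb 2 ρ.trace.re : ℝ) : EReal)
            ≤ ((Real.logb 2 (Fintype.card a) : ℝ) : EReal)) := by
  obtain ⟨hpos, ht, -⟩ := hρ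
  obtain ⟨⟨i, j⟩⟩ := QEntropy.nonempty_of_trace_pos ht
  have : Nonempty a := ⟨i⟩
  have : Nonempty b := ⟨j⟩
  refine ⟨?_, ?_⟩
  · obtain ⟨h, hh, h1, -, h3⟩ := QEntropy.condMinEntropy_bounds hpos ht
    rw [hh]
    exact ⟨mod_cast h1, mod_cast h3⟩
  · rintro c _ ω ⟨⟨ψ, rfl⟩, hω⟩
    have htr := QEntropy.trace_ptraceB (Matrix.vecMulVec ψ (star ψ))
    rw [hω] at htr
    have hsum := QEntropy.ptraceB_vecMulVec ψ
    rw [QEntropy.condMaxEntropy]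
    generalize QEntropy.ptraceB (Matrix.vecMulVec ψ (star ψ)) = τ at htr hsum ⊢
    rw [← htr] at ht ⊢
    have hτ : τ.PosSemidef := by
      rw [hsum]
      exact Matrix.posSemidef_sum _ fun _ _ => Matrix.posSemidef_vecMulVec_self_star _
    obtain ⟨⟨-, k⟩⟩ := QEntropy.nonempty_of_trace_pos ht
    have : Nonempty c := ⟨k⟩
    -- The discarded bound involves `dim C`, which is arbitrary; only the bounds in `dim A` are
    -- useful, and `h4` supplies `dim B`.
    obtain ⟨h, hh, -, h2, h3⟩ := QEntropy.condMinEntropy_bounds hτ ht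
    have h4 := QEntropy.condMinEntropy_sum_vecMulVec_le _ hsum ht
    have hb : (Fintype.card b : ℝ) ≠ 0 := mod_cast Fintype.card_ne_zero
    rw [hh, EReal.coe_le_coe_iff, Real.logb_div ht.ne' hb] at h4
    rw [hh]
    norm_cast
    refine ⟨?_, by linarith⟩
    rcases min_choice (Fintype.card a) (Fintype.card b) with hm | hm <;> rw [hm] <;> linarith
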